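/- **Architecture diagrams.** A BIP architecture diagram consists of a finite set $\mathcal T$ of component types and a finite set $\mathcal C$ of connector motifs. Each component type $T$ has a non-empty finite set $T.P$ of port types (every port type belongs to exactly one component type) and a cardinality $n\in\mathbb N$; $n_p$ denotes the cardinality of the component type that contains the port type $p$. There are $n$ component instances of each type $T$, and each of them has one port instance of every port type in $T.P$; so a port type $p$ has $n_p$ port instances. A connector motif is a tuple $\Gamma=(a,\{m_p:d_p,\,t_p\}_{p\in a})$ with a non-empty set $a$ of port types, multiplicities $m_p\ge 1$, degrees $d_p\in\mathbb N$ and typings $t_p\in\{\text{synchron},\text{trigger}\}$. A connector is a set of port instances, each typed as synchron or trigger. Its interactions are: if it contains a trigger, all sets of its ports that contain a trigger; otherwise only the set of all its ports. (Interactions are non-empty sets of port instances.) A configuration of a motif $\Gamma$ is a non-empty set $\gamma_\Gamma$ of connectors that involve only instances of port types in $a$, such that for each $p\in a$ every connector in $\gamma_\Gamma$ contains exactly $m_p$ instances of $p$, all typed as $t_p$, and every instance of $p$ is involved in exactly $d_p$ connectors in $\gamma_\Gamma$. An architecture with set of connectors $\gamma$ conforms to the diagram if $\gamma$ is partitioned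 into pairwise disjoint sets $\gamma_\Gamma$ ($\Gamma\in\mathcal C$), where $\gamma_\Gamma$ is a configuration of $\Gamma$. **Logic and macros.** Formulas of first-order interaction logic (FOIL) are built from $\mathit{true}$, atoms $c.p$ ($c$ a component variable, $p$ a port type), negation, disjunction and quantifiers $\exists c{:}T\,(Pr(c)).\,\Phi$ over the component instances of type $T$, where $Pr$ is a Boolean combination of equalities of component variables. A closed formula is evaluated at an interaction by reading $c.p$ as "the port instance $p$ of $c$ belongs to the interaction"; a set of interactions satisfies $\Phi$ if all its members make $\Phi$ true, and the configuration defined by $\Phi$ is the greatest set of interactions that satisfies $\Phi$. The macros abbreviate closed FOIL formulas: * $p\ \mathbf{Require}\ o_1;\dots;o_k$, where each option $o_i$ is a finite list of port types with repetitions (possibly empty): for every component $c_0$ of the type of $p$ there is an option $o_i$ such that for every port type $q$ that occurs in $o_i$, say $k_q$ times, there are $k_q$ distinct components $c_1,\dots,c_{k_q}$ of the type of $q$ ($c_0$ is not excluded) with $c_0.p\Rightarrow c_1.q\wedge\dots\wedge c_{k_q}.q$, and with $c_0.p\Rightarrow\neg\, c.q$ for every other component $c$ of that type; * $p\ \mathbf{Accept}\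 A$, where $A$ is a set of port types (possibly empty): for every component $c_0$ of the type of $p$, every port type $r\notin A$ and every component $c$ of the type of $r$ (with $c\ne c_0$ if $r=p$), $c_0.p\Rightarrow\neg\, c.r$. A diagram *can be specified in FOIL using the Require/Accept macro-notation* if one can choose, for each connector motif $\Gamma\in\mathcal C$, a finite conjunction $\Phi_\Gamma$ of Require and Accept macros such that some architecture conforms to the diagram, and for every conforming architecture $\gamma$ and every partition $(\gamma_\Gamma)_{\Gamma\in\mathcal C}$ of $\gamma$ that witnesses the conformance, the configuration defined by $\Phi_\Gamma$ is the set of interactions of the connectors in $\gamma_\Gamma$, for each $\Gamma$, and the configuration defined by $\bigvee_{\Gamma}\Phi_\Gamma$ is the set of interactions of the connectors in $\gamma$. **Corollary.** A BIP architecture diagram can be specified in FOIL using the Require/Accept macro-notation if and only if, for each connector motif $\Gamma=(a,\{m_p:d_p,\,t_p\}_{p\in a})$ of the diagram and each $p\in a$, 1. $m_p\le n_p$, and 2. $s_p=\prod_{q\in a}\binom{n_q}{m_q}$, where $s_p=n_p\,d_p/m_p\in\mathbb Q$ is the matching factor of $p$. -/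

import Mathlib

namespace BIP

/-! ## Architecture diagrams -/

/-- The typing of a port in a connector or in a connector motif. -/
inductive Typing : Type
  | synchron : Typing
  | trigger : Typing

/-- A connector motif `(a, {m_p : d_p, t_p}_{p ∈ a})` over the port types `P`. The data are functions
on the set `a` only, so that two motifs are equal iff they agree as tuples. -/
structure Motif (P : Type*) where
  ports : Finset P
  nonempty : ports.Nonempty
  mult : {p // p ∈ ports} → ℕ
  mult_pos : ∀ p, 0 < mult p
  deg : {p // p ∈ ports} → ℕ
  typing : {p // p ∈ ports} → Typing

/-- A BIP architecture diagram with component types `T` and port types `P`. Every port type belongs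
to exactly one component type, every component type has at least one port type, and `card t` is the
cardinality (number of instances) of the component type `t`. -/
structure Diagram (T P : Type*) where
  typeOf : P → T
  typeOf_surjective : Function.Surjective typeOf
  card : T → ℕ
  motifs : Finset (Motif P)

namespace Diagram

variable {T P : Type*} (D : Diagram T P)

/-- `n_p`: the cardinality of the component type that contains the port type `p`. -/
def numOf (p : P) : ℕ := D.card (D.typeOf p)

/-- The component instances: `card t` instances of every component type `t`. -/
def Component : Type _ := Σ t : T, Fin (D.card t)

/-- The port instances `p_i`, `1 ≤ i ≤ n_p`. -/
def PortInst : Type _ := Σ p : P, Fin (D.numOf p)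

variable {D}

/-- The port type of a port instance. -/
def PortInst.portType (x : D.PortInst) : P := x.1

/-- The component instance that a port instance belongs to: `p_i` is the port `c.p` of the `i`-th
instance `c` of the component type of `p`. -/
def PortInst.component (x : D.PortInst) : D.Component := ⟨D.typeOf x.1, x.2⟩

variable (D)

/-- A connector: a set of port instances, each with a typing. `none` means that the port instance
is not attached to the connector. -/
def Connector : Type _ := D.PortInst → Option Typing

variable {D}

/-- The port instances of a connector. -/
def Connector.ports (k : D.Connector) : Set D.PortInst := {x | k x ≠ none}

/-- The interactions of a connector: if some port of the connector is a trigger, all sets of its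
ports that contain a trigger; otherwise only the set of all its ports. Interactions are
non-empty sets of port instances. -/
def Connector.interactions (k : D.Connector) : Set (Set D.PortInst) :=
  {a | a.Nonempty ∧ a ⊆ k.ports ∧
    ((∃ x, k x = some Typing.trigger) → ∃ x ∈ a, k x = some Typing.trigger) ∧
    ((¬ ∃ x, k x = some Typing.trigger) → a = k.ports)}

/-- The interactions of a set of connectors. -/
def interactionsOf (γ : Set D.Connector) : Set (Set D.PortInst) :=
  {a | ∃ k ∈ γ, a ∈ k.interactions}

variable (D)

/-- `γ` is one of the configurations defined by the connector motif `Γ`: a non-empty set of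
connectors between port instances of the types in `Γ`, in each of which every port type `p` of `Γ`
has exactly `m_p` instances, all typed as `t_p`, and such that every instance of `p` is involved in
exactly `d_p` of them. -/
def IsConfiguration (Γ : Motif P) (γ : Set D.Connector) : Prop :=
  γ.Nonempty ∧
  (∀ k ∈ γ, ∀ x ∈ k.ports, x.portType ∈ Γ.ports) ∧
  ∀ p : {p // p ∈ Γ.ports},
    (∀ k ∈ γ, {x ∈ k.ports | x.portType = p}.ncard = Γ.mult p ∧
      ∀ x ∈ k.ports, x.portType = p → k x = some (Γ.typing p)) ∧
    (∀ x : D.PortInst, x.portType = p → {k ∈ γ | x ∈ k.ports}.ncard = Γ.deg p)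

/-- The sets `part Γ`, one for each connector motif `Γ` of the diagram, are a partition of `γ` that
witnesses that the architecture with connectors `γ` conforms to the diagram. -/
def IsConformingPartition (γ : Set D.Connector)
    (part : {Γ // Γ ∈ D.motifs} → Set D.Connector) : Prop :=
  Pairwise (fun Γ Γ' => Disjoint (part Γ) (part Γ')) ∧
  (⋃ Γ, part Γ) = γ ∧
  ∀ Γ, D.IsConfiguration Γ.1 (part Γ)

/-- The architecture with the connectors `γ` conforms to the diagram. -/
def Conforms (γ : Set D.Connector) : Prop :=
  ∃ part, D.IsConformingPartition γ part

/-- The matching factor `s_p = n_p * d_p / m_p` of a port type of a connector motif. -/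
def matchingFactor (Γ : Motif P) (p : {p // p ∈ Γ.ports}) : ℚ :=
  (D.numOf p : ℚ) * (Γ.deg p : ℚ) / (Γ.mult p : ℚ)

end Diagram

/-! ## First-order interaction logic -/

/-- Set-theoretic predicates on component variables: Boolean combinations of equalities. The
variables of a context of length `n` are the elements of `Fin n`, in the order of introduction. -/
inductive Pred : ℕ → Type
  | tt {n : ℕ} : Pred n
  | eq {n : ℕ} (i j : Fin n) : Pred n
  | neg {n : ℕ} (φ : Pred n) : Pred n
  | disj {n : ℕ} (φ ψ : Pred n) : Pred n

/-- First-order interaction logic, with component variables in `Fin n`: `true`, the port atoms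
`c.p`, negation, disjunction, and `∃ c : t (Pr c). Φ`, where the newly bound variable `c` is the
last one of the enlarged context. The closed formulas are those in `FOIL T P 0`. -/
inductive FOIL (T P : Type*) : ℕ → Type _
  | tt {n : ℕ} : FOIL T P n
  | port {n : ℕ} (c : Fin n) (p : P) : FOIL T P n
  | neg {n : ℕ} (Φ : FOIL T P n) : FOIL T P n
  | disj {n : ℕ} (Φ Ψ : FOIL T P n) : FOIL T P n
  | ex {n : ℕ} (t : T) (Pr : Pred (n + 1)) (Φ : FOIL T P (n + 1)) : FOIL T P n

/-- The truth of a predicate under an assignment of components to its variables. -/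
def Pred.Holds {C : Type*} : {n : ℕ} → Pred n → (Fin n → C) → Prop
  | _, .tt, _ => True
  | _, .eq i j, v => v i = v j
  | _, .neg φ, v => ¬ φ.Holds v
  | _, .disj φ ψ, v => φ.Holds v ∨ ψ.Holds v

/-- The truth of a formula under the valuation induced by the interaction `a` and an assignment of
components to the free variables: a port atom `c.p` is true iff the port instance `c.p` belongs
to `a`. -/
def FOIL.Holds {T P : Type*} {D : Diagram T P} (a : Set D.PortInst) :
    {n : ℕ} → FOIL T P n → (Fin n → D.Component) → Prop
  | _, .tt, _ => True
  | _, .port c p, v => ∃ x ∈ a, x.portType = p ∧ x.component = v c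
  | _, .neg Φ, v => ¬ Φ.Holds a v
  | _, .disj Φ Ψ, v => Φ.Holds a v ∨ Ψ.Holds a v
  | _, .ex t Pr Φ, v => ∃ c : D.Component, c.1 = t ∧
      Pr.Holds (Fin.snoc v c : Fin _ → D.Component) ∧
      Φ.Holds a (Fin.snoc v c : Fin _ → D.Component)

/-- A set of interactions satisfies a closed formula iff each of the interactions makes it true. -/
def FOIL.Sat {T P : Type*} {D : Diagram T P} (I : Set (Set D.PortInst)) (Φ : FOIL T P 0) : Prop :=
  ∀ a ∈ I, Φ.Holds a Fin.elim0

/-- `I` is the configuration defined by the closed formula `Φ`: the greatest set of interactions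
(that is, of non-empty sets of port instances) that satisfies `Φ`. -/
def FOIL.Defines {T P : Type*} {D : Diagram T P} (Φ : FOIL T P 0) (I : Set (Set D.PortInst)) :
    Prop :=
  IsGreatest {J | (∀ a ∈ J, a.Nonempty) ∧ Φ.Sat J} I

/-! Derived connectives. -/

/-- Conjunction of predicates. -/
def Pred.conj {n : ℕ} (φ ψ : Pred n) : Pred n := .neg (.disj (.neg φ) (.neg ψ))

/-- The variable `i` differs from all variables of a list. -/
def Pred.neAll {n : ℕ} (i : Fin n) (l : List (Fin n)) : Pred n :=
  l.foldr (fun j φ => .conj (.neg (.eq i j)) φ) .tt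

namespace FOIL

variable {T P : Type*} {n : ℕ}

/-- Conjunction. -/
def conj (Φ Ψ : FOIL T P n) : FOIL T P n := .neg (.disj (.neg Φ) (.neg Ψ))

/-- Implication. -/
def imp (Φ Ψ : FOIL T P n) : FOIL T P n := .disj (.neg Φ) Ψ

/-- The universal quantifier `∀ c : t (Pr c). Φ`. -/
def all (t : T) (Pr : Pred (n + 1)) (Φ : FOIL T P (n + 1)) : FOIL T P n :=
  .neg (.ex t Pr (.neg Φ))

/-- Finite conjunctions. -/
def bigConj (l : List (FOIL T P n)) : FOIL T P n := l.foldr conj .tt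

/-- Finite disjunctions; the empty one is false. -/
def bigDisj (l : List (FOIL T P n)) : FOIL T P n := l.foldr .disj (.neg .tt)

/-- `∃ c_1, …, c_k : t (pairwise distinct). Φ`, below the variable `0`; the variable `c_j` is the
element `j` of the context. -/
def exDistinct (t : T) : (k : ℕ) → FOIL T P (1 + k) → FOIL T P 1
  | 0, Φ => Φ
  | k + 1, Φ => exDistinct t k (.ex t
      (.neAll (Fin.last (1 + k)) ((List.finRange k).map fun j => (Fin.natAdd 1 j).castSucc)) Φ)

end FOIL

/-! ## The Require/Accept macro-notation -/

/-- The part of the Require macro for the port type `p` that concerns `k` occurrences of the port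
type `q` (`t` is the component type of `q`); the variable `0` is the component of `p`:
`∃ c_1, …, c_k : t (distinct). ((c_0.p ⇒ c_1.q ⋯ c_k.q) ∧
  ∀ c : t (c ≠ c_1, …, c_k). (c_0.p ⇒ ¬ c.q))`. -/
def requireExactly {T P : Type*} (t : T) (p q : P) (k : ℕ) : FOIL T P 1 :=
  .exDistinct t k (.conj
    (.imp (.port (Fin.castAdd k 0) p)
      (.bigConj ((List.finRange k).map fun j => .port (Fin.natAdd 1 j) q)))
    (.all t
      (.neAll (Fin.last (1 + k)) ((List.finRange k).map fun j => (Fin.natAdd 1 j).castSucc))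
      (.imp (.port (Fin.castAdd k (0 : Fin 1)).castSucc p) (.neg (.port (Fin.last (1 + k)) q)))))

/-- The macros. `require p os` is `p Require o_1 ; … ; o_k`, where every option `o_i` is a list of
port types with repetitions; the empty option is the dash. `accept p A` is `p Accept A`; the empty
set is the dash. -/
inductive Macro (P : Type*) : Type _
  | require (p : P) (os : List (List P)) : Macro P
  | accept (p : P) (A : Finset P) : Macro P

/-- The formula that a macro stands for.
* `require p os`: `∀ c_0`, for some option, every port type `q` of the option occurs exactly as many
  times as in the option whenever `c_0.p` participates.
* `accept p A`: for all `c_0` and every port type `r ∉ A`, no port instance of type `r` (other than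
  `c_0.p` itself) participates together with `c_0.p`. -/
noncomputable def Macro.formula {T P : Type*} [Fintype P] [DecidableEq P] (typeOf : P → T) :
    Macro P → FOIL T P 0
  | .require p os => .all (typeOf p) .tt (.bigDisj (os.map fun o =>
      .bigConj (o.dedup.map fun q => requireExactly (typeOf q) p q (o.count q))))
  | .accept p A => .all (typeOf p) .tt (.bigConj ((Finset.univ \ A).toList.map fun r =>
      .all (typeOf r) (if r = p then .neg (.eq 0 1) else .tt)
        (.imp (.port 0 p) (.neg (.port 1 r)))))

/-- The formula of a list of macros: the conjunction of their formulas. -/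
noncomputable def macrosFormula {T P : Type*} [Fintype P] [DecidableEq P] (typeOf : P → T)
    (M : List (Macro P)) : FOIL T P 0 :=
  .bigConj (M.map (Macro.formula typeOf))

namespace Diagram

variable {T P : Type*} (D : Diagram T P)

/-- The formulas `F Γ`, one for each connector motif `Γ`, specify the diagram: there is an
architecture that conforms to the diagram, and in every conforming architecture the connectors that
correspond to the motif `Γ` have exactly the interactions that `F Γ` defines, and all connectors
together have exactly the interactions that the disjunction of the formulas `F Γ` defines. -/
def SpecifiedBy (F : {Γ // Γ ∈ D.motifs} → FOIL T P 0) : Prop :=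
  (∃ γ, D.Conforms γ) ∧
  ∀ γ part, D.IsConformingPartition γ part →
    (∀ Γ, (F Γ).Defines (interactionsOf (part Γ))) ∧
    (FOIL.bigDisj (D.motifs.attach.toList.map F)).Defines (interactionsOf γ)

/-- The diagram can be specified in first-order interaction logic using the Require/Accept
macro-notation. -/
def MacroSpecifiable [Fintype P] [DecidableEq P] : Prop :=
  ∃ M : {Γ // Γ ∈ D.motifs} → List (Macro P),
    D.SpecifiedBy fun Γ => macrosFormula D.typeOf (M Γ)

end Diagram

end BIP

/-!
The Require and Accept macros cannot see which instances of a port type participate in an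
interaction, only how many do: the truth of a macro at an interaction `a` depends on the function
`count a` alone (`holds_require`, `holds_accept`, `holds_macrosFormula_congr`). Let `shaped Γ` be the
set of all connectors that consist of `m_p` instances of each port type `p` of the motif `Γ`, typed
as `t_p`; it has `∏ q, (n_q choose m_q)` elements (`ncard_shaped`). A configuration of `Γ` is a
subset of `shaped Γ`.

If macros define the interactions of a configuration of `Γ`, these interactions are closed under
replacing the participants of a port type by equally many others. The port sets of the connectors
of the configuration are among the interactions, hence so are the port sets of all connectors in
`shaped Γ`, and the configuration is all of `shaped Γ` (`eq_shaped_of_defines`). Double counting the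
pairs of an instance of `p` and a connector that contains it (`numOf_mul_eq_ncard_mul`) gives
`n_p * d_p = m_p * ∏ q, (n_q choose m_q)`.

Conversely, under the two conditions the same double counting shows that `shaped Γ` is the only
configuration of `Γ` (`isConfiguration_iff_eq_shaped`); that it is one, with the right degrees,
follows since its connectors are spread evenly over the instances of a port type. Distinct motifs
have disjoint sets `shaped Γ`, because a connector determines its motif up to the degrees and the
degrees are then determined by the matching condition (`eq_of_mem_shaped`). So there is exactly one
conforming partition, and its interactions are described by explicit macros
(`defines_interactionsOf_shaped`).
-/

namespace BIP

/-! ### Semantics of the derived connectives -/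

theorem Pred.holds_neAll {C : Type*} {n : ℕ} (i : Fin n) (l : List (Fin n)) (v : Fin n → C) :
    (Pred.neAll i l).Holds v ↔ ∀ j ∈ l, v i ≠ v j := by
  induction l with
  | nil => simp [Pred.neAll, Pred.Holds]
  | cons j l ih =>
    have h : Pred.neAll i (j :: l) = Pred.conj (.neg (.eq i j)) (Pred.neAll i l) := rfl
    rw [h]
    simp [Pred.conj, Pred.Holds, ih]

namespace FOIL

variable {T P : Type*} {D : Diagram T P} {n : ℕ} (a : Set D.PortInst)

theorem holds_conj (Φ Ψ : FOIL T P n) (v : Fin n → D.Component) :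
    (conj Φ Ψ).Holds a v ↔ Φ.Holds a v ∧ Ψ.Holds a v := by
  simp [conj, Holds]

theorem holds_imp (Φ Ψ : FOIL T P n) (v : Fin n → D.Component) :
    (imp Φ Ψ).Holds a v ↔ (Φ.Holds a v → Ψ.Holds a v) := by
  simp only [imp, Holds]; tauto

theorem holds_all (t : T) (Pr : Pred (n + 1)) (Φ : FOIL T P (n + 1)) (v : Fin n → D.Component) :
    (all t Pr Φ).Holds a v ↔ ∀ c : D.Component, c.1 = t →
      Pr.Holds (Fin.snoc v c : Fin _ → D.Component) →
      Φ.Holds a (Fin.snoc v c : Fin _ → D.Component) := by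
  simp [all, Holds]

theorem holds_bigConj (l : List (FOIL T P n)) (v : Fin n → D.Component) :
    (bigConj l).Holds a v ↔ ∀ Φ ∈ l, Φ.Holds a v := by
  induction l with
  | nil => simp [bigConj, Holds]
  | cons Φ l ih =>
    change (conj Φ (bigConj l)).Holds a v ↔ _
    simp [holds_conj, ih]

theorem holds_bigDisj (l : List (FOIL T P n)) (v : Fin n → D.Component) :
    (bigDisj l).Holds a v ↔ ∃ Φ ∈ l, Φ.Holds a v := by
  induction l with
  | nil => simp [bigDisj, Holds]
  | cons Φ l ih =>
    change (Φ.Holds a v ∨ (bigDisj l).Holds a v) ↔ _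
    simp [ih]

theorem holds_exDistinct (t : T) (k : ℕ) (Φ : FOIL T P (1 + k)) (v : Fin 1 → D.Component) :
    (exDistinct t k Φ).Holds a v ↔ ∃ w : Fin k → D.Component, Function.Injective w ∧
      (∀ j, (w j).1 = t) ∧ Φ.Holds a (Fin.append v w) := by
  induction k with
  | zero =>
    have append_eq (w : Fin 0 → D.Component) :
        (Fin.append v w : Fin (1 + 0) → D.Component) = v := by
      funext i
      exact Fin.append_left v w i
    constructor
    · intro h
      exact ⟨Fin.elim0, fun i => i.elim0, fun i => i.elim0, by rwa [append_eq]⟩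
    · rintro ⟨w, -, -, h⟩
      rwa [append_eq] at h
  | succ k ih =>
    rw [exDistinct, ih]
    constructor
    · rintro ⟨w, hw, ht, c, hc, hPr, h⟩
      refine ⟨Fin.snoc w c, ?_, ?_, ?_⟩
      · rw [Fin.snoc_injective_iff]
        refine ⟨hw, ?_⟩
        rintro ⟨j, rfl⟩
        rw [Pred.holds_neAll] at hPr
        refine hPr (Fin.natAdd 1 j).castSucc (List.mem_map.2 ⟨j, List.mem_finRange j, rfl⟩) ?_
        rw [Fin.snoc_last, Fin.snoc_castSucc, Fin.append_right]
      · intro j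
        induction j using Fin.lastCases with
        | last => simpa using hc
        | cast j => simpa using ht j
      · rw [Fin.append_snoc]; exact h
    · rintro ⟨w, hw, ht, h⟩
      obtain ⟨w, c, rfl⟩ : ∃ w' c, w = Fin.snoc w' c :=
        ⟨Fin.init w, w (Fin.last k), (Fin.snoc_init_self w).symm⟩
      rw [Fin.snoc_injective_iff] at hw
      refine ⟨w, hw.1, fun j => by simpa using ht j.castSucc, c, by simpa using ht (Fin.last k),
        ?_, ?_⟩
      · rw [Pred.holds_neAll]
        intro i hi
        obtain ⟨j, -, rfl⟩ := List.mem_map.1 hi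
        simp only [Fin.snoc_last, Fin.snoc_castSucc, Fin.append_right]
        exact fun h => hw.2 ⟨j, h.symm⟩
      · rw [← Fin.append_snoc]; exact h

/-- The set of interactions defined by a formula is the set of all interactions that satisfy it. -/
theorem defines_iff (Φ : FOIL T P 0) (I : Set (Set D.PortInst)) :
    Φ.Defines I ↔ I = {a | a.Nonempty ∧ Φ.Holds a Fin.elim0} := by
  have h : IsGreatest {J : Set (Set D.PortInst) | (∀ a ∈ J, a.Nonempty) ∧ Φ.Sat J}
      {a | a.Nonempty ∧ Φ.Holds a Fin.elim0} :=
    ⟨⟨fun a ha => ha.1, fun a ha => ha.2⟩, fun J hJ a ha => ⟨hJ.1 a ha, hJ.2 a ha⟩⟩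
  exact ⟨fun h' => h'.unique h, fun h' => h' ▸ h⟩

end FOIL

/-! ### Semantics of the macros -/

namespace Diagram

variable {T P : Type*} {D : Diagram T P}

instance : Finite Typing :=
  Finite.of_injective (fun t : Typing => Typing.rec (motive := fun _ => Bool) true false t)
    (by rintro (_ | _) (_ | _) <;> simp)

instance [Finite P] : Finite D.PortInst := inferInstanceAs (Finite (Σ p : P, Fin (D.numOf p)))

instance [Finite P] : Finite D.Connector := inferInstanceAs (Finite (D.PortInst → Option Typing))

/-- The number of port instances of type `p` in a set of port instances. -/
noncomputable def count (a : Set D.PortInst) (p : P) : ℕ := {x ∈ a | x.portType = p}.ncard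

/-- The components `c` for which the port instance `c.p` belongs to `a`. -/
def participants (a : Set D.PortInst) (p : P) : Set D.Component :=
  {c | ∃ x ∈ a, x.portType = p ∧ x.component = c}

theorem ncard_participants (a : Set D.PortInst) (p : P) :
    (participants a p).ncard = count a p := by
  have h : participants a p = PortInst.component '' {x ∈ a | x.portType = p} := by
    ext c; simp [participants, and_assoc]
  rw [h, count]
  refine Set.InjOn.ncard_image ?_
  rintro ⟨q, i⟩ ⟨-, hq⟩ ⟨r, j⟩ ⟨-, hr⟩ hij
  obtain rfl : q = p := hq
  obtain rfl : r = q := hr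
  obtain rfl : i = j := eq_of_heq (Sigma.mk.inj hij).2
  rfl

theorem type_of_mem_participants {a : Set D.PortInst} {p : P} {c : D.Component}
    (hc : c ∈ participants a p) : c.1 = D.typeOf p := by
  obtain ⟨x, -, rfl, rfl⟩ := hc
  rfl

/-- The `i`-th component instance of type `t`. -/
def Component.ofIndex (t : T) (i : Fin (D.card t)) : D.Component := ⟨t, i⟩

theorem Component.ofIndex_injective (t : T) :
    Function.Injective (Component.ofIndex t : Fin (D.card t) → D.Component) :=
  fun _ _ h => eq_of_heq (Sigma.mk.inj h).2

theorem setOf_type_eq (t : T) : {c : D.Component | c.1 = t} =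
    Set.range (Component.ofIndex t) := by
  ext ⟨s, i⟩
  constructor
  · rintro rfl; exact ⟨i, rfl⟩
  · rintro ⟨j, hj⟩; exact (congrArg Sigma.fst hj).symm

theorem finite_setOf_type_eq (t : T) : {c : D.Component | c.1 = t}.Finite := by
  rw [setOf_type_eq]; exact Set.finite_range _

theorem ncard_setOf_type_eq (t : T) : {c : D.Component | c.1 = t}.ncard = D.card t := by
  rw [setOf_type_eq, Set.ncard_range_of_injective (Component.ofIndex_injective t),
    Nat.card_fin]

theorem finite_participants (a : Set D.PortInst) (p : P) : (participants a p).Finite :=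
  (finite_setOf_type_eq (D.typeOf p)).subset fun _ => type_of_mem_participants

theorem count_le_numOf (a : Set D.PortInst) (p : P) : count a p ≤ D.numOf p := by
  rw [← ncard_participants, numOf, ← ncard_setOf_type_eq]
  exact Set.ncard_le_ncard (fun _ => type_of_mem_participants) (finite_setOf_type_eq _)

theorem count_pos_iff {a : Set D.PortInst} {p : P} :
    0 < count a p ↔ (participants a p).Nonempty := by
  rw [← ncard_participants, Set.ncard_pos (finite_participants a p)]

theorem holds_requireExactly (a : Set D.PortInst) (p q : P) (k : ℕ) (v : Fin 1 → D.Component) :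
    (requireExactly (D.typeOf q) p q k).Holds a v ↔
      k ≤ D.numOf q ∧ (v 0 ∈ participants a p → count a q = k) := by
  have key : (requireExactly (D.typeOf q) p q k).Holds a v ↔
      ∃ w : Fin k → D.Component, Function.Injective w ∧ (∀ j, (w j).1 = D.typeOf q) ∧
        (v 0 ∈ participants a p → ∀ j, w j ∈ participants a q) ∧
        ∀ c : D.Component, c.1 = D.typeOf q → (∀ j, c ≠ w j) →
          v 0 ∈ participants a p → c ∉ participants a q := by
    rw [requireExactly, FOIL.holds_exDistinct]
    refine exists_congr fun w => and_congr_right fun _ => and_congr_right fun _ => ?_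
    rw [FOIL.holds_conj, FOIL.holds_imp, FOIL.holds_all, FOIL.holds_bigConj]
    simp only [List.forall_mem_map, List.mem_finRange, true_imp_iff, Fin.append_left,
      Fin.append_right, Pred.holds_neAll, FOIL.holds_imp, FOIL.Holds, Fin.snoc_last,
      Fin.snoc_castSucc]
    rfl
  rw [key]
  constructor
  · rintro ⟨w, hw, ht, h₁, h₂⟩
    have hcard : (Set.range w).ncard = k := by
      rw [Set.ncard_range_of_injective hw, Nat.card_fin]
    refine ⟨?_, fun hp => ?_⟩
    · rw [numOf, ← ncard_setOf_type_eq, ← hcard]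
      exact Set.ncard_le_ncard (Set.range_subset_iff.2 ht) (finite_setOf_type_eq _)
    · rw [← ncard_participants, ← hcard]
      congr 1
      refine Set.Subset.antisymm (fun c hc => ?_) (Set.range_subset_iff.2 (h₁ hp))
      by_contra hcw
      exact h₂ c (type_of_mem_participants hc) (fun j hj => hcw ⟨j, hj.symm⟩) hp hc
  · rintro ⟨hk, h⟩
    have enum {s : Set D.Component} (hs : s.Finite) (hc : s.ncard = k) :
        ∃ w : Fin k → D.Component, Function.Injective w ∧ Set.range w = s := by
      have := hs.to_subtype
      have e : Fin k ≃ s := (Finite.equivFinOfCardEq hc).symm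
      exact ⟨fun j => e j, Subtype.val_injective.comp e.injective, by
        rw [Set.range_comp' Subtype.val e, e.range_eq_univ, Set.image_univ, Subtype.range_coe]⟩
    by_cases hp : v 0 ∈ participants a p
    · obtain ⟨w, hw, hr⟩ := enum (finite_participants a q)
        ((ncard_participants a q).trans (h hp))
      have hmem (j : Fin k) : w j ∈ participants a q := hr ▸ Set.mem_range_self j
      refine ⟨w, hw, fun j => type_of_mem_participants (hmem j), fun _ => hmem, ?_⟩
      intro c _ hc _ hcq
      rw [← hr] at hcq
      obtain ⟨j, rfl⟩ := hcq
      exact hc j rfl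
    · rw [numOf, ← ncard_setOf_type_eq] at hk
      obtain ⟨s, hs, hsk⟩ := Set.exists_subset_card_eq hk
      obtain ⟨w, hw, hr⟩ := enum ((finite_setOf_type_eq _).subset hs) hsk
      exact ⟨w, hw, fun j => hs (hr ▸ Set.mem_range_self j), fun h => absurd h hp,
        fun _ _ _ h => absurd h hp⟩

section Macros

variable [Fintype P] [DecidableEq P]

/-- A Require macro says two things: some option does not ask for more components than there are,
and, if `p` participates, the counts of some option are exactly right. The first part comes from
the position of the quantifiers `∃ c₁ … c_k` outside of the implications `c₀.p ⇒ …`. -/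
theorem holds_require (a : Set D.PortInst) (p : P) (os : List (List P)) :
    ((Macro.require p os).formula D.typeOf).Holds a Fin.elim0 ↔
      (0 < D.numOf p → ∃ o ∈ os, ∀ q ∈ o, o.count q ≤ D.numOf q) ∧
      (0 < count a p → ∃ o ∈ os, ∀ q ∈ o, count a q = o.count q) := by
  have key : ((Macro.require p os).formula D.typeOf).Holds a Fin.elim0 ↔
      ∀ c : D.Component, c.1 = D.typeOf p → ∃ o ∈ os, ∀ q ∈ o,
        o.count q ≤ D.numOf q ∧ (c ∈ participants a p → count a q = o.count q) := by
    rw [Macro.formula, FOIL.holds_all]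
    refine forall_congr' fun c => imp_congr_right fun _ => ?_
    simp only [FOIL.holds_bigDisj, FOIL.holds_bigConj, List.mem_map, exists_exists_and_eq_and,
      forall_exists_index, and_imp, forall_apply_eq_imp_iff₂, List.mem_dedup,
      holds_requireExactly, Pred.Holds, true_imp_iff]
    rfl
  rw [key]
  constructor
  · refine fun h => ⟨fun hn => ?_, fun hp => ?_⟩
    · obtain ⟨o, ho, h'⟩ := h ⟨D.typeOf p, ⟨0, hn⟩⟩ rfl
      exact ⟨o, ho, fun q hq => (h' q hq).1⟩
    · obtain ⟨c, hc⟩ := count_pos_iff.1 hp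
      obtain ⟨o, ho, h'⟩ := h c (type_of_mem_participants hc)
      exact ⟨o, ho, fun q hq => (h' q hq).2 hc⟩
  · rintro ⟨h₁, h₂⟩ ⟨t, i⟩ rfl
    by_cases hc : (⟨D.typeOf p, i⟩ : D.Component) ∈ participants a p
    · obtain ⟨o, ho, h'⟩ := h₂ (count_pos_iff.2 ⟨_, hc⟩)
      exact ⟨o, ho, fun q hq => ⟨h' q hq ▸ count_le_numOf a q, fun _ => h' q hq⟩⟩
    · obtain ⟨o, ho, h'⟩ := h₁ i.pos
      exact ⟨o, ho, fun q hq => ⟨h' q hq, fun h => absurd h hc⟩⟩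

theorem holds_accept (a : Set D.PortInst) (p : P) (A : Finset P) :
    ((Macro.accept p A).formula D.typeOf).Holds a Fin.elim0 ↔
      (0 < count a p → ∀ r ∉ A, if r = p then count a r ≤ 1 else count a r = 0) := by
  have key : ((Macro.accept p A).formula D.typeOf).Holds a Fin.elim0 ↔
      ∀ c : D.Component, c.1 = D.typeOf p → ∀ r ∉ A, ∀ c' : D.Component, c'.1 = D.typeOf r →
        (r = p → c ≠ c') → c ∈ participants a p → c' ∉ participants a r := by
    rw [Macro.formula, FOIL.holds_all]
    refine forall_congr' fun c => imp_congr_right fun _ => ?_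
    simp only [FOIL.holds_bigConj, List.forall_mem_map, Finset.mem_toList, Finset.mem_sdiff,
      Finset.mem_univ, true_and, Pred.Holds, true_imp_iff]
    refine forall_congr' fun r => imp_congr_right fun _ => ?_
    rw [FOIL.holds_all]
    refine forall_congr' fun c' => imp_congr_right fun _ => ?_
    rw [FOIL.holds_imp]
    refine imp_congr ?_ Iff.rfl
    split_ifs with h
    · simp only [h, true_imp_iff, Pred.Holds]; exact Iff.rfl
    · simp [h, Pred.Holds]
  rw [key]
  constructor
  · intro h hp r hr
    obtain ⟨c, hc⟩ := count_pos_iff.1 hp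
    split_ifs with hrp
    · subst hrp
      rw [← ncard_participants, Set.ncard_le_one (finite_participants a r)]
      intro x hx y hy
      by_contra hxy
      exact h x (type_of_mem_participants hx) r hr y (type_of_mem_participants hy) (fun _ => hxy)
        hx hy
    · rw [← Nat.le_zero, ← not_lt, count_pos_iff]
      rintro ⟨c', hc'⟩
      exact h c (type_of_mem_participants hc) r hr c' (type_of_mem_participants hc')
        (fun h => absurd h hrp) hc hc'
  · intro h c _ r hr c' _ hne hc hc'
    have := h (count_pos_iff.2 ⟨c, hc⟩) r hr
    split_ifs at this with hrp
    · subst hrp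
      rw [← ncard_participants, Set.ncard_le_one (finite_participants a r)] at this
      exact hne rfl (this c hc c' hc')
    · exact (count_pos_iff.2 ⟨c', hc'⟩).ne' this

theorem holds_macrosFormula (a : Set D.PortInst) (M : List (Macro P)) :
    (macrosFormula D.typeOf M).Holds a Fin.elim0 ↔
      ∀ m ∈ M, (m.formula D.typeOf).Holds a Fin.elim0 := by
  simp only [macrosFormula, FOIL.holds_bigConj, List.forall_mem_map]

/-- The macros cannot see which instances of a port type participate, only how many. -/
theorem holds_macrosFormula_congr {a b : Set D.PortInst} (h : count a = count b)
    (M : List (Macro P)) :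
    (macrosFormula D.typeOf M).Holds a Fin.elim0 ↔
      (macrosFormula D.typeOf M).Holds b Fin.elim0 := by
  rw [holds_macrosFormula, holds_macrosFormula]
  refine forall₂_congr fun m _ => ?_
  cases m with
  | require p os => rw [holds_require, holds_require, h]
  | accept p A => rw [holds_accept, holds_accept, h]

end Macros

/-! ### Connectors of the shape of a motif -/

variable (D) in
/-- The set of all connectors that have the shape which the motif `Γ` prescribes: exactly `m_p`
instances of each `p ∈ a`, typed as `t_p`, and nothing else. The degrees play no role. -/
def shaped (Γ : Motif P) : Set D.Connector :=
  {k | (∀ x ∈ k.ports, x.portType ∈ Γ.ports) ∧ ∀ p : {p // p ∈ Γ.ports},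
    count k.ports p = Γ.mult p ∧ ∀ x ∈ k.ports, x.portType = p → k x = some (Γ.typing p)}

theorem isConfiguration_iff {Γ : Motif P} {γ : Set D.Connector} :
    D.IsConfiguration Γ γ ↔ γ.Nonempty ∧ γ ⊆ D.shaped Γ ∧ ∀ p : {p // p ∈ Γ.ports},
      ∀ x : D.PortInst, x.portType = p → {k ∈ γ | x ∈ k.ports}.ncard = Γ.deg p := by
  constructor
  · rintro ⟨h₁, h₂, h₃⟩
    exact ⟨h₁, fun k hk => ⟨h₂ k hk, fun p => (h₃ p).1 k hk⟩, fun p => (h₃ p).2⟩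
  · rintro ⟨h₁, h₂, h₃⟩
    exact ⟨h₁, fun k hk => (h₂ hk).1, fun p => ⟨fun k hk => (h₂ hk).2 p, h₃ p⟩⟩

theorem typing_of_mem_shaped {Γ : Motif P} {k : D.Connector} (hk : k ∈ D.shaped Γ) {x : D.PortInst}
    (hx : x ∈ k.ports) : k x = some (Γ.typing ⟨x.portType, hk.1 x hx⟩) :=
  (hk.2 ⟨x.portType, hk.1 x hx⟩).2 x hx rfl

theorem ext_of_mem_shaped {Γ : Motif P} {k k' : D.Connector} (hk : k ∈ D.shaped Γ)
    (hk' : k' ∈ D.shaped Γ) (h : k.ports = k'.ports) : k = k' := by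
  funext x
  by_cases hx : x ∈ k.ports
  · rw [typing_of_mem_shaped hk hx, typing_of_mem_shaped hk' (h ▸ hx)]
  · have hx' : x ∉ k'.ports := h ▸ hx
    rw [not_not.1 hx, not_not.1 hx']

/-- The `i`-th instance of the port type `p`. -/
def PortInst.ofIndex (p : P) (i : Fin (D.numOf p)) : D.PortInst := ⟨p, i⟩

theorem PortInst.ofIndex_injective (p : P) :
    Function.Injective (PortInst.ofIndex p : Fin (D.numOf p) → D.PortInst) :=
  fun _ _ h => eq_of_heq (Sigma.mk.inj h).2

theorem count_eq_ncard (a : Set D.PortInst) (p : P) :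
    count a p = {i : Fin (D.numOf p) | PortInst.ofIndex p i ∈ a}.ncard := by
  rw [count, ← (PortInst.ofIndex_injective p).injOn.ncard_image]
  congr 1
  ext x
  constructor
  · obtain ⟨q, i⟩ := x
    rintro ⟨hx, rfl : q = p⟩
    exact ⟨i, hx, rfl⟩
  · rintro ⟨i, hi, rfl⟩
    exact ⟨hi, rfl⟩

open Classical in
/-- The connector of the shape of `Γ` whose instances of the port type `p` are those with index in
`s p`. -/
noncomputable def ofIndices (Γ : Motif P)
    (s : (p : {p // p ∈ Γ.ports}) → Finset (Fin (D.numOf p))) : D.Connector :=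
  fun x => if h : ∃ hp : x.1 ∈ Γ.ports, x.2 ∈ s ⟨x.1, hp⟩ then
    some (Γ.typing ⟨x.1, h.1⟩) else none

theorem mem_ports_ofIndices {Γ : Motif P}
    {s : (p : {p // p ∈ Γ.ports}) → Finset (Fin (D.numOf p))} {x : D.PortInst} :
    x ∈ (ofIndices Γ s).ports ↔ ∃ hp : x.1 ∈ Γ.ports, x.2 ∈ s ⟨x.1, hp⟩ := by
  simp [Connector.ports, ofIndices]

theorem ofIndex_mem_ports_ofIndices {Γ : Motif P}
    {s : (p : {p // p ∈ Γ.ports}) → Finset (Fin (D.numOf p))} (p : {p // p ∈ Γ.ports})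
    {i : Fin (D.numOf p)} : PortInst.ofIndex p.1 i ∈ (ofIndices Γ s).ports ↔ i ∈ s p := by
  rw [mem_ports_ofIndices]
  exact ⟨fun h => h.2, fun h => ⟨p.2, h⟩⟩

theorem ofIndices_mem_shaped {Γ : Motif P}
    {s : (p : {p // p ∈ Γ.ports}) → Finset (Fin (D.numOf p))} (hs : ∀ p, (s p).card = Γ.mult p) :
    ofIndices Γ s ∈ D.shaped Γ := by
  refine ⟨fun x hx => (mem_ports_ofIndices.1 hx).1, fun p => ⟨?_, ?_⟩⟩
  · rw [count_eq_ncard, ← hs p, ← Set.ncard_coe_finset]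
    congr 1
    ext i
    exact ofIndex_mem_ports_ofIndices p
  · obtain ⟨p, hp⟩ := p
    rintro x hx rfl
    rw [ofIndices, dif_pos (mem_ports_ofIndices.1 hx)]
    rfl

theorem ofIndices_injective (Γ : Motif P) : Function.Injective (ofIndices (D := D) Γ) := by
  intro s s' h
  funext p
  ext i
  rw [← ofIndex_mem_ports_ofIndices, h, ofIndex_mem_ports_ofIndices]

/-- Connectors of the shape of `Γ` amount to a choice of `m_p` of the `n_p` instances for each `p`. -/
theorem ncard_shaped (Γ : Motif P) : (D.shaped Γ).ncard =
    ∏ q : {q // q ∈ Γ.ports}, (D.numOf q).choose (Γ.mult q) := by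
  classical
  have h : D.shaped Γ = ofIndices Γ '' (Fintype.piFinset fun q : {q // q ∈ Γ.ports} =>
      (Finset.univ : Finset (Fin (D.numOf q))).powersetCard (Γ.mult q) : Set _) := by
    ext k
    constructor
    · intro hk
      have hs (p : {p // p ∈ Γ.ports}) :
          (Finset.univ.filter fun i => PortInst.ofIndex p.1 i ∈ k.ports).card = Γ.mult p := by
        rw [← (hk.2 p).1, count_eq_ncard, ← Set.ncard_coe_finset]
        simp
      refine ⟨fun p => Finset.univ.filter fun i => PortInst.ofIndex p.1 i ∈ k.ports, ?_, ?_⟩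
      · simpa [Finset.mem_powersetCard] using hs
      · refine ext_of_mem_shaped (ofIndices_mem_shaped hs) hk ?_
        ext x
        rw [mem_ports_ofIndices]
        simp only [Finset.mem_filter, Finset.mem_univ, true_and]
        exact ⟨fun h => h.2, fun h => ⟨hk.1 x h, h⟩⟩
    · rintro ⟨s, hs, rfl⟩
      refine ofIndices_mem_shaped fun p => ?_
      have := Fintype.mem_piFinset.1 (Finset.mem_coe.1 hs) p
      exact (Finset.mem_powersetCard.1 this).2
  rw [h, (ofIndices_injective Γ).injOn.ncard_image, Set.ncard_coe_finset, Fintype.card_piFinset]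
  simp

theorem ncard_shaped_pos {Γ : Motif P} (hle : ∀ p : {p // p ∈ Γ.ports}, Γ.mult p ≤ D.numOf p) :
    0 < (D.shaped Γ).ncard := by
  rw [ncard_shaped]
  exact Finset.prod_pos fun q _ => Nat.choose_pos (hle q)

theorem matchingFactor_eq_iff {Γ : Motif P} {p : {p // p ∈ Γ.ports}} {N : ℕ} :
    D.matchingFactor Γ p = (N : ℚ) ↔ D.numOf p * Γ.deg p = N * Γ.mult p := by
  have : (Γ.mult p : ℚ) ≠ 0 := by exact_mod_cast (Γ.mult_pos p).ne'
  rw [matchingFactor, div_eq_iff this]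
  norm_cast

section Counting

variable [Finite P]

/-- Double counting of the pairs of a connector and an instance of `p` in it. -/
theorem numOf_mul_eq_ncard_mul {Γ : Motif P} {γ : Set D.Connector} (hγ : γ ⊆ D.shaped Γ)
    (p : {p // p ∈ Γ.ports}) {d : ℕ}
    (hd : ∀ x : D.PortInst, x.portType = p → {k ∈ γ | x ∈ k.ports}.ncard = d) :
    D.numOf p * d = γ.ncard * Γ.mult p := by
  classical
  have hfin : γ.Finite := γ.toFinite
  have := Finset.card_mul_eq_card_mul (s := (Finset.univ : Finset (Fin (D.numOf p))))
    (t := hfin.toFinset) (m := d) (n := Γ.mult p)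
    (fun i k => PortInst.ofIndex p.1 i ∈ k.ports) ?_ ?_
  · rwa [Finset.card_univ, Fintype.card_fin, ← Set.ncard_eq_toFinset_card γ hfin] at this
  · intro i _
    rw [← hd (PortInst.ofIndex p.1 i) rfl, ← Set.ncard_coe_finset]
    congr 1
    ext k
    simp [Finset.bipartiteAbove]
  · intro k hk
    rw [← ((hγ (hfin.mem_toFinset.1 hk)).2 p).1, count_eq_ncard, ← Set.ncard_coe_finset]
    congr 1
    ext i
    simp [Finset.bipartiteBelow]

/-- Exchanging two port instances of the same type preserves the shape of a connector, so that both
are involved in equally many connectors of that shape. -/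
theorem ncard_shaped_mem_ports_le (Γ : Motif P) {x y : D.PortInst} (h : x.portType = y.portType) :
    {k ∈ D.shaped Γ | x ∈ k.ports}.ncard ≤ {k ∈ D.shaped Γ | y ∈ k.ports}.ncard := by
  classical
  set σ := Equiv.swap x y
  have hσ (z : D.PortInst) : (σ z).portType = z.portType := by
    by_cases hx : z = x
    · subst hx; rw [Equiv.swap_apply_left, h]
    by_cases hy : z = y
    · subst hy; rw [Equiv.swap_apply_right, h]
    rw [Equiv.swap_apply_of_ne_of_ne hx hy]
  let f : D.Connector → D.Connector := fun k z => k (σ z)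
  have hf (k : D.Connector) (z) : z ∈ (f k).ports ↔ σ z ∈ k.ports := Iff.rfl
  have hinj : Function.Injective f := fun k k' hk => funext fun z => by
    have := congrFun hk (σ.symm z)
    simpa [f] using this
  refine Set.ncard_le_ncard_of_injOn f ?_ hinj.injOn (Set.toFinite _)
  rintro k ⟨hk, hx⟩
  refine ⟨⟨fun z hz => hσ z ▸ hk.1 _ hz, fun p => ⟨?_, fun z hz hp => ?_⟩⟩, ?_⟩
  · rw [← (hk.2 p).1, count, count, ← (σ.injective.injOn).ncard_image]
    congr 1
    ext z
    rw [σ.image_eq_preimage_symm]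
    simp [hf, ← hσ (σ.symm z)]
  · exact (hk.2 p).2 (σ z) hz ((hσ z).trans hp)
  · rw [hf, Equiv.swap_apply_right]; exact hx

theorem ncard_shaped_mem_ports_congr (Γ : Motif P) {x y : D.PortInst}
    (h : x.portType = y.portType) :
    {k ∈ D.shaped Γ | x ∈ k.ports}.ncard = {k ∈ D.shaped Γ | y ∈ k.ports}.ncard :=
  (ncard_shaped_mem_ports_le Γ h).antisymm (ncard_shaped_mem_ports_le Γ h.symm)

end Counting

theorem count_eq_zero_of_forall {a : Set D.PortInst} {p : P} (h : ∀ x ∈ a, x.portType ≠ p) :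
    count a p = 0 := by
  have : {x ∈ a | x.portType = p} = ∅ :=
    Set.eq_empty_of_forall_notMem fun x hx => h x hx.1 hx.2
  rw [count, this, Set.ncard_empty]

theorem count_eq_of_mem_shaped {Γ : Motif P} {k k' : D.Connector} (hk : k ∈ D.shaped Γ)
    (hk' : k' ∈ D.shaped Γ) : count k.ports = count k'.ports := by
  funext p
  by_cases hp : p ∈ Γ.ports
  · exact (hk.2 ⟨p, hp⟩).1.trans (hk'.2 ⟨p, hp⟩).1.symm
  · rw [count_eq_zero_of_forall fun x hx (h : x.portType = p) => hp (h ▸ hk.1 x hx),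
      count_eq_zero_of_forall fun x hx (h : x.portType = p) => hp (h ▸ hk'.1 x hx)]

theorem exists_mem_ports_of_mem_shaped {Γ : Motif P} {k : D.Connector} (hk : k ∈ D.shaped Γ)
    (p : {p // p ∈ Γ.ports}) : ∃ x ∈ k.ports, x.portType = p := by
  by_contra! h
  have := (hk.2 p).1
  rw [count_eq_zero_of_forall h] at this
  exact (Γ.mult_pos p).ne this

theorem ports_nonempty_of_mem_shaped {Γ : Motif P} {k : D.Connector} (hk : k ∈ D.shaped Γ) :
    k.ports.Nonempty := by
  obtain ⟨p, hp⟩ := Γ.nonempty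
  obtain ⟨x, hx, -⟩ := exists_mem_ports_of_mem_shaped hk ⟨p, hp⟩
  exact ⟨x, hx⟩

/-- A connector of the shape of `Γ` determines the whole motif but for its degrees. -/
theorem eq_of_mem_shaped {Γ Γ' : Motif P} {k : D.Connector} (hk : k ∈ D.shaped Γ)
    (hk' : k ∈ D.shaped Γ')
    (hdeg : D.shaped Γ = D.shaped Γ' → ∀ (p : P) (hp : p ∈ Γ.ports) (hp' : p ∈ Γ'.ports),
      Γ.mult ⟨p, hp⟩ = Γ'.mult ⟨p, hp'⟩ → Γ.deg ⟨p, hp⟩ = Γ'.deg ⟨p, hp'⟩) : Γ = Γ' := by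
  have hports : Γ.ports = Γ'.ports := by
    ext p
    constructor
    · intro hp
      obtain ⟨x, hx, rfl⟩ := exists_mem_ports_of_mem_shaped hk ⟨p, hp⟩
      exact hk'.1 x hx
    · intro hp
      obtain ⟨x, hx, rfl⟩ := exists_mem_ports_of_mem_shaped hk' ⟨p, hp⟩
      exact hk.1 x hx
  have hmult (q) (hq : q ∈ Γ.ports) (hq' : q ∈ Γ'.ports) : Γ.mult ⟨q, hq⟩ = Γ'.mult ⟨q, hq'⟩ :=
    (hk.2 ⟨q, hq⟩).1.symm.trans (hk'.2 ⟨q, hq'⟩).1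
  have htyping (q) (hq : q ∈ Γ.ports) (hq' : q ∈ Γ'.ports) :
      Γ.typing ⟨q, hq⟩ = Γ'.typing ⟨q, hq'⟩ := by
    obtain ⟨x, hx, hxq⟩ := exists_mem_ports_of_mem_shaped hk ⟨q, hq⟩
    exact Option.some.inj (((hk.2 ⟨q, hq⟩).2 x hx hxq).symm.trans ((hk'.2 ⟨q, hq'⟩).2 x hx hxq))
  obtain ⟨ports, _, mult, _, deg, typing⟩ := Γ
  obtain ⟨ports', _, mult', _, deg', typing'⟩ := Γ'
  obtain rfl : ports = ports' := hports
  obtain rfl : mult = mult' := funext fun q => hmult q.1 q.2 q.2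
  obtain rfl : typing = typing' := funext fun q => htyping q.1 q.2 q.2
  obtain rfl : deg = deg' := funext fun q => hdeg rfl q.1 q.2 q.2 rfl
  rfl

/-! ### Interactions of connectors of the shape of a motif -/

/-- A motif has a trigger port. -/
def HasTrigger (Γ : Motif P) : Prop := ∃ p, Γ.typing p = Typing.trigger

theorem exists_trigger_iff {Γ : Motif P} {k : D.Connector} (hk : k ∈ D.shaped Γ) :
    (∃ x, k x = some Typing.trigger) ↔ HasTrigger Γ := by
  constructor
  · rintro ⟨x, hx⟩
    have hx' : x ∈ k.ports := by simp [Connector.ports, hx]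
    exact ⟨_, Option.some.inj ((typing_of_mem_shaped hk hx').symm.trans hx)⟩
  · rintro ⟨p, hp⟩
    obtain ⟨x, hx, hxp⟩ := exists_mem_ports_of_mem_shaped hk p
    exact ⟨x, hp ▸ (hk.2 p).2 x hx hxp⟩

/-- If the formulas define the interactions of the parts, their disjunction defines the interactions
of the union. -/
theorem bigDisj_defines {F : {Γ // Γ ∈ D.motifs} → FOIL T P 0}
    {part : {Γ // Γ ∈ D.motifs} → Set D.Connector}
    (h : ∀ Γ, (F Γ).Defines (interactionsOf (part Γ))) :
    (FOIL.bigDisj (D.motifs.attach.toList.map F)).Defines (interactionsOf (⋃ Γ, part Γ)) := by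
  rw [FOIL.defines_iff]
  have h' (Γ) (a : Set D.PortInst) :
      a ∈ interactionsOf (part Γ) ↔ a.Nonempty ∧ (F Γ).Holds a Fin.elim0 := by
    rw [(FOIL.defines_iff _ _).1 (h Γ)]; rfl
  ext a
  have hU : a ∈ interactionsOf (⋃ Γ, part Γ) ↔ ∃ Γ, a ∈ interactionsOf (part Γ) := by
    simp only [interactionsOf, Set.mem_iUnion, Set.mem_ofPred_eq]
    exact ⟨fun ⟨k, ⟨Γ, hk⟩, ha⟩ => ⟨Γ, k, hk, ha⟩, fun ⟨Γ, k, hk, ha⟩ => ⟨k, ⟨Γ, hk⟩, ha⟩⟩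
  rw [hU, Set.mem_ofPred_eq, FOIL.holds_bigDisj]
  simp [h']

section Finite

variable [Finite P]

theorem count_mono {a b : Set D.PortInst} (h : a ⊆ b) (p : P) : count a p ≤ count b p :=
  Set.ncard_le_ncard fun _ hx => ⟨h hx.1, hx.2⟩

theorem eq_of_subset_of_count_le {a b : Set D.PortInst} (h : a ⊆ b)
    (hc : ∀ p, count b p ≤ count a p) : a = b := by
  refine h.antisymm fun x hx => ?_
  have : {y ∈ a | y.portType = x.portType} = {y ∈ b | y.portType = x.portType} :=
    Set.eq_of_subset_of_ncard_le (fun y hy => ⟨h hy.1, hy.2⟩) (hc x.portType)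
  exact (this.symm.subset ⟨hx, rfl⟩ : x ∈ {y ∈ a | y.portType = x.portType}).1

theorem count_pos_of_mem {a : Set D.PortInst} {x : D.PortInst} (hx : x ∈ a) :
    0 < count a x.portType :=
  (Set.ncard_pos (Set.toFinite _)).2 ⟨x, hx, rfl⟩

theorem exists_mem_of_count_pos {a : Set D.PortInst} {p : P} (h : 0 < count a p) :
    ∃ x ∈ a, x.portType = p :=
  (Set.ncard_pos (Set.toFinite _)).1 h

/-- Under the matching condition the configuration of a motif is unique: by double counting it
has as many connectors as there are connectors of the right shape. -/
theorem isConfiguration_iff_eq_shaped {Γ : Motif P}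
    (hle : ∀ p : {p // p ∈ Γ.ports}, Γ.mult p ≤ D.numOf p)
    (hmatch : ∀ p : {p // p ∈ Γ.ports},
      D.numOf p * Γ.deg p = (D.shaped Γ).ncard * Γ.mult p) (γ : Set D.Connector) :
    D.IsConfiguration Γ γ ↔ γ = D.shaped Γ := by
  rw [isConfiguration_iff]
  constructor
  · rintro ⟨-, hγ, hdeg⟩
    obtain ⟨p, hp⟩ := Γ.nonempty
    have h := numOf_mul_eq_ncard_mul hγ ⟨p, hp⟩ (hdeg ⟨p, hp⟩)
    rw [hmatch ⟨p, hp⟩] at h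
    exact Set.eq_of_subset_of_ncard_le hγ (Nat.eq_of_mul_eq_mul_right (Γ.mult_pos _) h).le
  · rintro rfl
    refine ⟨Set.nonempty_of_ncard_ne_zero (ncard_shaped_pos hle).ne', subset_rfl, ?_⟩
    intro p x hx
    have h := numOf_mul_eq_ncard_mul (subset_refl (D.shaped Γ)) p fun y hy =>
      ncard_shaped_mem_ports_congr Γ (hy.trans hx.symm)
    rw [← hmatch p] at h
    exact Nat.eq_of_mul_eq_mul_left ((Γ.mult_pos p).trans_le (hle p)) h

theorem mem_interactionsOf_shaped {Γ : Motif P}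
    (hle : ∀ p : {p // p ∈ Γ.ports}, Γ.mult p ≤ D.numOf p) {a : Set D.PortInst} :
    a ∈ interactionsOf (D.shaped Γ) ↔ a.Nonempty ∧ (∀ x ∈ a, x.portType ∈ Γ.ports) ∧
      (∀ p : {p // p ∈ Γ.ports}, count a p ≤ Γ.mult p) ∧
      (HasTrigger Γ → ∃ p : {p // p ∈ Γ.ports}, Γ.typing p = Typing.trigger ∧ 0 < count a p) ∧
      (¬ HasTrigger Γ → ∀ p : {p // p ∈ Γ.ports}, count a p = Γ.mult p) := by
  classical
  constructor
  · rintro ⟨k, hk, hne, hsub, htrig, hsync⟩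
    rw [exists_trigger_iff hk] at htrig hsync
    refine ⟨hne, fun x hx => hk.1 x (hsub hx), fun p => (hk.2 p).1 ▸ count_mono hsub p, ?_, ?_⟩
    · intro h
      obtain ⟨x, hx, hxt⟩ := htrig h
      exact ⟨_, Option.some.inj ((typing_of_mem_shaped hk (hsub hx)).symm.trans hxt),
        count_pos_of_mem hx⟩
    · intro h p
      rw [hsync h]
      exact (hk.2 p).1
  · rintro ⟨hne, hports, hcount, htrig, hsync⟩
    have hs (p : {p // p ∈ Γ.ports}) : ∃ s : Finset (Fin (D.numOf p)),
        (Finset.univ.filter fun i => PortInst.ofIndex p.1 i ∈ a) ⊆ s ∧ s.card = Γ.mult p := by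
      refine Finset.exists_superset_card_eq ?_ (by simpa using hle p)
      rw [← Set.ncard_coe_finset]
      simpa [count_eq_ncard] using hcount p
    choose s hsub hcard using hs
    have hk : ofIndices Γ s ∈ D.shaped Γ := ofIndices_mem_shaped hcard
    have hak : a ⊆ (ofIndices Γ s).ports := fun x hx =>
      mem_ports_ofIndices.2 ⟨hports x hx, hsub ⟨_, hports x hx⟩
        (Finset.mem_filter.2 ⟨Finset.mem_univ _, hx⟩)⟩
    refine ⟨_, hk, hne, hak, ?_⟩
    rw [exists_trigger_iff hk]
    refine ⟨fun h => ?_, fun h => ?_⟩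
    · obtain ⟨p, hp, hpos⟩ := htrig h
      obtain ⟨x, hx, hxp⟩ := exists_mem_of_count_pos hpos
      exact ⟨x, hx, hp ▸ (hk.2 p).2 x (hak hx) hxp⟩
    · refine eq_of_subset_of_count_le hak fun p => ?_
      by_cases hp : p ∈ Γ.ports
      · exact ((hk.2 ⟨p, hp⟩).1.trans (hsync h ⟨p, hp⟩).symm).le
      · rw [count_eq_zero_of_forall fun x hx (h : x.portType = p) => hp (h ▸ hk.1 x hx)]
        exact Nat.zero_le _

end Finite

/-! ### Macros that define the interactions of a motif -/

theorem forall_mem_replicate_count_eq [DecidableEq P] {k : ℕ} (hk : 0 < k) (q : P) (f : P → ℕ) :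
    (∀ r ∈ List.replicate k q, f r = (List.replicate k q).count r) ↔ f q = k := by
  simp [List.mem_replicate, hk.ne']

variable [Fintype P] [DecidableEq P]

/-- The Require options "exactly `k` instances of `q`" for `1 ≤ k ≤ m_q`. -/
def upToOptions (Γ : Motif P) (q : {p // p ∈ Γ.ports}) : List (List P) :=
  (List.range (Γ.mult q)).map fun k => List.replicate (k + 1) q.1

theorem holds_require_replicate (a : Set D.PortInst) (p : P) {q : P} {k : ℕ} (hk : 0 < k)
    (hle : k ≤ D.numOf q) :
    ((Macro.require p [List.replicate k q]).formula D.typeOf).Holds a Fin.elim0 ↔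
      (0 < count a p → count a q = k) := by
  have feasible : ∀ r ∈ List.replicate k q, (List.replicate k q).count r ≤ D.numOf r := by
    simpa [List.mem_replicate] using fun _ => hle
  rw [holds_require, and_iff_right fun _ => ⟨_, List.mem_singleton_self _, feasible⟩]
  simp only [List.mem_singleton, exists_eq_left, forall_mem_replicate_count_eq hk]

theorem holds_require_upToOptions {Γ : Motif P}
    (hle : ∀ p : {p // p ∈ Γ.ports}, Γ.mult p ≤ D.numOf p) (a : Set D.PortInst) (p : P)
    {S : List {p // p ∈ Γ.ports}} (hS : S ≠ []) :
    ((Macro.require p (S.flatMap (upToOptions Γ))).formula D.typeOf).Holds a Fin.elim0 ↔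
      (0 < count a p → ∃ q ∈ S, 0 < count a q ∧ count a q ≤ Γ.mult q) := by
  have mem_options (o : List P) : o ∈ S.flatMap (upToOptions Γ) ↔
      ∃ q ∈ S, ∃ k < Γ.mult q, List.replicate (k + 1) q.1 = o := by
    simp [upToOptions]
  obtain ⟨q, hq⟩ := List.exists_mem_of_ne_nil S hS
  have feasible : ∀ r ∈ List.replicate 1 q.1, (List.replicate 1 q.1).count r ≤ D.numOf r := by
    simpa using Nat.succ_le_of_lt ((Γ.mult_pos q).trans_le (hle q))
  rw [holds_require, and_iff_right fun _ =>
    ⟨_, (mem_options _).2 ⟨q, hq, 0, Γ.mult_pos q, rfl⟩, feasible⟩]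
  refine imp_congr_right fun _ => ?_
  simp only [mem_options]
  constructor
  · rintro ⟨_, ⟨q, hq, k, hk, rfl⟩, h⟩
    rw [forall_mem_replicate_count_eq k.succ_pos] at h
    exact ⟨q, hq, by omega, by omega⟩
  · rintro ⟨q, hq, h₁, h₂⟩
    exact ⟨_, ⟨q, hq, count a q - 1, by omega, rfl⟩,
      (forall_mem_replicate_count_eq (Nat.succ_pos _) _ _).2 (by omega)⟩

/-- The macros that forbid the participation of the port types outside of `Γ`. A Require macro
with no option is no help, as it is false at every interaction (unless there are no instances of
`p`); instead `p` requires some `q ∈ a` and accepts nothing, and these two macros contradict each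
other as soon as `p` participates, but hold if it does not. -/
noncomputable def forbidMacros (Γ : Motif P) : List (Macro P) :=
  (Finset.univ \ Γ.ports).toList.flatMap fun p =>
    [.require p [List.replicate 1 Γ.nonempty.choose], .accept p ∅]

theorem holds_forbidMacros {Γ : Motif P}
    (hle : ∀ p : {p // p ∈ Γ.ports}, Γ.mult p ≤ D.numOf p) (a : Set D.PortInst) :
    (∀ m ∈ forbidMacros Γ, (m.formula D.typeOf).Holds a Fin.elim0) ↔
      ∀ x ∈ a, x.portType ∈ Γ.ports := by
  have hq := Γ.nonempty.choose_spec
  have hle' : 1 ≤ D.numOf Γ.nonempty.choose := (Γ.mult_pos ⟨_, hq⟩).trans_le (hle ⟨_, hq⟩)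
  simp only [forbidMacros, List.mem_flatMap, Finset.mem_toList, Finset.mem_sdiff, Finset.mem_univ,
    true_and, forall_exists_index, and_imp]
  constructor
  · intro h x hx
    by_contra hxp
    have h₁ := h _ _ hxp (List.mem_cons_self ..)
    have h₂ := h _ _ hxp (List.mem_cons_of_mem _ (List.mem_singleton_self _))
    rw [holds_require_replicate a _ one_pos hle'] at h₁
    rw [holds_accept] at h₂
    have h₃ := h₂ (count_pos_of_mem hx) _ (Finset.notMem_empty Γ.nonempty.choose)
    have hne : Γ.nonempty.choose ≠ x.portType := fun h' => hxp (h' ▸ hq)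
    rw [if_neg hne, h₁ (count_pos_of_mem hx)] at h₃
    exact one_ne_zero h₃
  · intro h m p hp hm
    have h0 : ¬ 0 < count a p := fun h' => by
      obtain ⟨x, hx, rfl⟩ := exists_mem_of_count_pos h'
      exact hp (h x hx)
    simp only [List.mem_cons, List.not_mem_nil, or_false] at hm
    obtain rfl | rfl := hm
    · exact (holds_require_replicate a _ one_pos hle').2 fun h' => absurd h' h0
    · exact (holds_accept a _ _).2 fun h' => absurd h' h0

open Classical in
/-- The macros for the port types of `Γ`. With a trigger: a participating port type has at most
`m_q` participants, and requires that some trigger port type participates. Without one: a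
participating port type requires exactly `m_q` instances of every `q ∈ a`. -/
noncomputable def shapeMacros (Γ : Motif P) : List (Macro P) :=
  if HasTrigger Γ then
    (Γ.ports.attach.toList.flatMap fun q => [.require q.1 ([q].flatMap (upToOptions Γ)),
      .require q.1 ((Γ.ports.attach.filter fun t => Γ.typing t = .trigger).toList.flatMap
        (upToOptions Γ))])
  else
    Γ.ports.attach.toList.flatMap fun p => Γ.ports.attach.toList.map fun q =>
      .require p.1 [List.replicate (Γ.mult q) q.1]

theorem holds_shapeMacros {Γ : Motif P}
    (hle : ∀ p : {p // p ∈ Γ.ports}, Γ.mult p ≤ D.numOf p) {a : Set D.PortInst}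
    (hne : a.Nonempty) (ha : ∀ x ∈ a, x.portType ∈ Γ.ports) :
    (∀ m ∈ shapeMacros Γ, (m.formula D.typeOf).Holds a Fin.elim0) ↔
      (∀ p : {p // p ∈ Γ.ports}, count a p ≤ Γ.mult p) ∧
      (HasTrigger Γ → ∃ p : {p // p ∈ Γ.ports}, Γ.typing p = Typing.trigger ∧ 0 < count a p) ∧
      (¬ HasTrigger Γ → ∀ p : {p // p ∈ Γ.ports}, count a p = Γ.mult p) := by
  classical
  obtain ⟨x, hx⟩ := hne
  by_cases htrig : HasTrigger Γ
  · have hS : (Γ.ports.attach.filter fun t => Γ.typing t = .trigger).toList ≠ [] := by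
      obtain ⟨t, ht⟩ := htrig
      exact List.ne_nil_of_mem
        (Finset.mem_toList.2 (Finset.mem_filter.2 ⟨Finset.mem_attach _ t, ht⟩))
    have key : (∀ m ∈ shapeMacros Γ, (m.formula D.typeOf).Holds a Fin.elim0) ↔
        ∀ q : {p // p ∈ Γ.ports}, 0 < count a q → count a q ≤ Γ.mult q ∧
          ∃ t, Γ.typing t = .trigger ∧ 0 < count a t ∧ count a t ≤ Γ.mult t := by
      rw [shapeMacros, if_pos htrig]
      simp only [List.forall_mem_flatMap, Finset.mem_toList, Finset.mem_attach, true_imp_iff,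
        List.forall_mem_cons, List.not_mem_nil, false_imp_iff, implies_true, and_true,
        holds_require_upToOptions hle a _ hS,
        holds_require_upToOptions hle a _ (List.cons_ne_nil _ _)]
      simp only [List.mem_singleton, exists_eq_left, Finset.mem_filter, Finset.mem_attach,
        true_and]
      exact forall_congr' fun q => ⟨fun h hq => ⟨(h.1 hq).2, h.2 hq⟩,
        fun h => ⟨fun hq => ⟨hq, (h hq).1⟩, fun hq => (h hq).2⟩⟩
    rw [key]
    constructor
    · refine fun h => ⟨fun p => ?_, fun _ => ?_, fun h' => absurd htrig h'⟩
      · rcases Nat.eq_zero_or_pos (count a p) with h0 | h0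
        · exact h0 ▸ Nat.zero_le _
        · exact (h p h0).1
      · obtain ⟨-, t, ht, hpos, -⟩ := h ⟨_, ha x hx⟩ (count_pos_of_mem hx)
        exact ⟨t, ht, hpos⟩
    · rintro ⟨h₁, h₂, -⟩ q -
      obtain ⟨t, ht, hpos⟩ := h₂ htrig
      exact ⟨h₁ q, t, ht, hpos, h₁ t⟩
  · have key : (∀ m ∈ shapeMacros Γ, (m.formula D.typeOf).Holds a Fin.elim0) ↔
        ∀ p q : {p // p ∈ Γ.ports}, 0 < count a p → count a q = Γ.mult q := by
      rw [shapeMacros, if_neg htrig]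
      simp only [List.forall_mem_flatMap, List.forall_mem_map, Finset.mem_toList,
        Finset.mem_attach, true_imp_iff]
      exact forall₂_congr fun p q => holds_require_replicate a _ (Γ.mult_pos q) (hle q)
    rw [key]
    constructor
    · intro h
      have h' (q : {p // p ∈ Γ.ports}) := h ⟨_, ha x hx⟩ q (count_pos_of_mem hx)
      exact ⟨fun p => (h' p).le, fun h => absurd h htrig, fun _ => h'⟩
    · exact fun h _ q _ => h.2.2 htrig q

theorem defines_interactionsOf_shaped {Γ : Motif P}
    (hle : ∀ p : {p // p ∈ Γ.ports}, Γ.mult p ≤ D.numOf p) :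
    (macrosFormula D.typeOf (forbidMacros Γ ++ shapeMacros Γ)).Defines
      (interactionsOf (D.shaped Γ)) := by
  rw [FOIL.defines_iff]
  ext a
  rw [mem_interactionsOf_shaped hle, Set.mem_ofPred_eq, holds_macrosFormula, List.forall_mem_append,
    holds_forbidMacros hle]
  refine and_congr_right fun hne => and_congr_right fun ha => (holds_shapeMacros hle hne ha).symm

/-- If the set of interactions of a configuration of `Γ` is defined by macros, it is closed under
the exchange of port instances of the same type, so that the configuration is full. -/
theorem eq_shaped_of_defines {Γ : Motif P} {γ : Set D.Connector} (hne : γ.Nonempty)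
    (hγ : γ ⊆ D.shaped Γ) {M : List (Macro P)}
    (hM : (macrosFormula D.typeOf M).Defines (interactionsOf γ)) : γ = D.shaped Γ := by
  refine hγ.antisymm fun k hk => ?_
  rw [FOIL.defines_iff] at hM
  obtain ⟨k₀, hk₀⟩ := hne
  have h₀ : k₀.ports ∈ interactionsOf γ := by
    refine ⟨k₀, hk₀, ports_nonempty_of_mem_shaped (hγ hk₀), subset_rfl, ?_, fun _ => rfl⟩
    rintro ⟨x, hx⟩
    exact ⟨x, by simp [Connector.ports, hx], hx⟩
  have hmem : k.ports ∈ interactionsOf γ := by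
    rw [hM] at h₀ ⊢
    exact ⟨ports_nonempty_of_mem_shaped hk,
      (holds_macrosFormula_congr (count_eq_of_mem_shaped hk (hγ hk₀)) M).2 h₀.2⟩
  obtain ⟨k', hk', -, hsub, -⟩ := hmem
  have heq := eq_of_subset_of_count_le hsub fun p =>
    (congrFun (count_eq_of_mem_shaped (hγ hk') hk) p).le
  rwa [ext_of_mem_shaped hk (hγ hk') heq]

end Diagram
end BIP

open BIP Diagram in
theorem corollary1 {T P : Type*} [Fintype P] [DecidableEq P] (D : BIP.Diagram T P) :
    D.MacroSpecifiable ↔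
      ∀ Γ ∈ D.motifs, ∀ p : {p // p ∈ Γ.ports},
        Γ.mult p ≤ D.numOf p ∧
        D.matchingFactor Γ p =
          ((∏ q : {q // q ∈ Γ.ports}, (D.numOf q).choose (Γ.mult q) : ℕ) : ℚ) := by
  simp only [matchingFactor_eq_iff, ← ncard_shaped]
  constructor
  · rintro ⟨M, ⟨γ, part, hpart⟩, hspec⟩ Γ hΓ p
    have hdef := (hspec γ part hpart).1 ⟨Γ, hΓ⟩
    obtain ⟨hne, hsub, hdeg⟩ := isConfiguration_iff.1 (hpart.2.2 ⟨Γ, hΓ⟩)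
    refine ⟨?_, ?_⟩
    · obtain ⟨k, hk⟩ := hne
      exact ((hsub hk).2 p).1 ▸ count_le_numOf _ _
    · rw [← eq_shaped_of_defines hne hsub hdef]
      exact numOf_mul_eq_ncard_mul hsub p (hdeg p)
  · intro h
    have hconf (Γ : {Γ // Γ ∈ D.motifs}) :=
      isConfiguration_iff_eq_shaped (fun p => (h Γ.1 Γ.2 p).1) (fun p => (h Γ.1 Γ.2 p).2)
    refine ⟨fun Γ => forbidMacros Γ.1 ++ shapeMacros Γ.1, ⟨_, fun Γ => D.shaped Γ.1, ?_, rfl,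
      fun Γ => (hconf Γ _).2 rfl⟩, ?_⟩
    · intro Γ Γ' hne
      refine Set.disjoint_left.2 fun k hk hk' => hne (Subtype.ext ?_)
      refine eq_of_mem_shaped hk hk' fun hshaped p hp hp' hmult => ?_
      obtain ⟨hle, h₁⟩ := h Γ.1 Γ.2 ⟨p, hp⟩
      have h₂ := (h Γ'.1 Γ'.2 ⟨p, hp'⟩).2
      rw [← hshaped, ← hmult, ← h₁] at h₂
      exact (Nat.eq_of_mul_eq_mul_left ((Γ.1.mult_pos _).trans_le hle) h₂).symm
    · rintro γ part ⟨-, rfl, hpart⟩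
      have hdef (Γ) : (macrosFormula D.typeOf (forbidMacros Γ.1 ++ shapeMacros Γ.1)).Defines
          (interactionsOf (part Γ)) := by
        rw [(hconf Γ _).1 (hpart Γ)]
        exact defines_interactionsOf_shaped fun p => (h Γ.1 Γ.2 p).1
      exact ⟨hdef, bigDisj_defines hdef⟩
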